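/- Let $\mathbb{F}_q$ be a finite field and let $1\le n\le m$ be integers. An $\mathbb{F}_q$-linear code is an $\mathbb{F}_q$-subspace $\mathcal C$ of the space $(\mathbb{F}_q)_{n,m}$ of $n\times m$ matrices over $\mathbb{F}_q$. Its dual is $\mathcal C^\perp=\{B\in(\mathbb{F}_q)_{n,m} : \mathrm{Tr}(BA^{T})=0 \text{ for all } A\in\mathcal C\}$, its minimum distance $d=d(\mathcal C)$ is the least rank of a nonzero element of $\mathcal C$, and its rank distribution is given by $A_i(\mathcal C)=|\{A\in\mathcal C:\mathrm{rank}(A)=i\}|$, $i\in\mathbb{N}$. If $t=\dim_{\mathbb{F}_q}\mathcal C$, the rank defect of $\mathcal C$ is $n-\lceil t/m\rceil+1-d$. The code $\mathcal C$ is called dually AMRD if both $\mathcal C$ and $\mathcal C^\perp$ have rank defect $1$, and formally self-dual if $A_i(\mathcal C)=A_i(\mathcal C^\perp)$ for all $i$. The rank of $v\in\mathbb{F}_{q^m}^n$ is the $\mathbb{F}_q$-dimension of the span of its coordinates. For an $\mathbb{F}_{q^m}$-subspace $C\le\mathbb{F}_{q^m}^n$ the minimum distance and the rank distribution are defined with this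 rank, and $C^\perp$ is the dual with respect to the standard inner product; $C$ is formally self-dual if $A_i(C)=A_i(C^\perp)$ for all $i$. Given an $\mathbb{F}_q$-basis $\mathcal B$ of $\mathbb{F}_{q^m}$, the associated code $\lambda_{\mathcal B}(C)\le(\mathbb{F}_q)_{n,m}$ consists of the matrices whose rows are the $\mathcal B$-coordinates of the entries of the elements of $C$, and $C$ is called dually AMRD if $\lambda_{\mathcal B}(C)$ is dually AMRD for some basis $\mathcal B$. A $[2d,d,d]$ code is an $\mathbb{F}_{q^m}$-subspace of $\mathbb{F}_{q^m}^{2d}$ of dimension $d$ and minimum distance $d$. (1) Let $\mathcal C\le(\mathbb{F}_q)_{n,m}$ be a dually AMRD $\mathbb{F}_q$-linear code of dimension $t$ and minimum distance $d$ with $t=\frac{nm}{2}=dm$. Then $\mathcal C$ is formally self-dual. (2) Let $n=2d\le m$ and let $C\le\mathbb{F}_{q^m}^{n}$ be a dually AMRD $\mathbb{F}_{q^m}$-linear $[2d,d,d]$ code. Then $C$ is formally self-dual. -/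

import Mathlib

open Module

namespace RankMetric

noncomputable section

/-! ### `F`-linear rank metric codes of `n × m` matrices -/

section MatrixCodes

variable {F : Type*} [Field F] {n m : ℕ}

/-- The dual of a matrix code: all `B` with `Tr (B Aᵗ) = 0` for every codeword `A`. -/
def matDual (C : Submodule F (Matrix (Fin n) (Fin m) F)) :
    Submodule F (Matrix (Fin n) (Fin m) F) where
  carrier := {B | ∀ A ∈ C, (B * A.transpose).trace = 0}
  add_mem' := by
    intro B B' hB hB' A hA
    rw [Matrix.add_mul, Matrix.trace_add, hB A hA, hB' A hA, add_zero]
  zero_mem' := by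
    intro A _
    rw [Matrix.zero_mul, Matrix.trace_zero]
  smul_mem' := by
    intro c B hB A hA
    rw [Matrix.smul_mul, Matrix.trace_smul, hB A hA, smul_zero]

/-- The minimum distance of a nonzero matrix code: the least rank of a nonzero codeword
(it is `0` by convention for the zero code). -/
def matMinDist (C : Submodule F (Matrix (Fin n) (Fin m) F)) : ℕ :=
  sInf {r | ∃ A ∈ C, A ≠ 0 ∧ A.rank = r}

/-- The number `A_i(C)` of codewords of rank `i`. -/
def matRankDist (C : Submodule F (Matrix (Fin n) (Fin m) F)) (i : ℕ) : ℕ :=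
  {A | A ∈ C ∧ A.rank = i}.ncard

/-- The rank defect `n - ⌈t / m⌉ + 1 - d` of a matrix code of dimension `t` and minimum
distance `d`. -/
def rankDefect (C : Submodule F (Matrix (Fin n) (Fin m) F)) : ℤ :=
  (n : ℤ) - ⌈(finrank F C : ℚ) / (m : ℚ)⌉ + 1 - (matMinDist C : ℤ)

/-- A matrix code is AMRD (almost maximum rank distance) if its rank defect is one. -/
def IsAMRD (C : Submodule F (Matrix (Fin n) (Fin m) F)) : Prop :=
  rankDefect C = 1

/-- A matrix code is dually AMRD if it and its dual are both AMRD. -/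
def IsDuallyAMRD (C : Submodule F (Matrix (Fin n) (Fin m) F)) : Prop :=
  IsAMRD C ∧ IsAMRD (matDual C)

/-- A matrix code is formally self-dual if it has the rank distribution of its dual. -/
def IsFormallySelfDual (C : Submodule F (Matrix (Fin n) (Fin m) F)) : Prop :=
  ∀ i : ℕ, matRankDist C i = matRankDist (matDual C) i

end MatrixCodes

/-! ### `K`-linear rank metric codes in `Kⁿ`, for an extension `K` of `F` -/

section VectorCodes

variable (F : Type*) {K : Type*} [Field F] [Field K] [Algebra F K] {n m : ℕ}

/-- The dual of a vector code for the standard inner product of `Kⁿ`. -/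
def vecDual (C : Submodule K (Fin n → K)) : Submodule K (Fin n → K) where
  carrier := {w | ∀ v ∈ C, w ⬝ᵥ v = 0}
  add_mem' := by
    intro w w' hw hw' v hv
    rw [add_dotProduct, hw v hv, hw' v hv, add_zero]
  zero_mem' := by
    intro v _
    rw [zero_dotProduct]
  smul_mem' := by
    intro c w hw v hv
    rw [smul_dotProduct, hw v hv, smul_zero]

/-- The rank of a vector: the dimension over `F` of the span of its coordinates. -/
def vecRank (v : Fin n → K) : ℕ :=
  finrank F (Submodule.span F (Set.range v))

/-- The minimum distance of a nonzero vector code: the least rank of a nonzero codeword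
(it is `0` by convention for the zero code). -/
def vecMinDist (C : Submodule K (Fin n → K)) : ℕ :=
  sInf {r | ∃ v ∈ C, v ≠ 0 ∧ vecRank F v = r}

/-- The number `A_i(C)` of codewords of rank `i`. -/
def vecRankDist (C : Submodule K (Fin n → K)) (i : ℕ) : ℕ :=
  {v | v ∈ C ∧ vecRank F v = i}.ncard

/-- A vector code is formally self-dual if it has the rank distribution of its dual. -/
def IsFormallySelfDualVec (C : Submodule K (Fin n → K)) : Prop :=
  ∀ i : ℕ, vecRankDist F C i = vecRankDist F (vecDual C) i

variable {F}

/-- The map `λ_𝓑` sending `v` to the matrix whose `i`-th row holds the coordinates of `v i`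
in the basis `𝓑`. -/
def basisExpansion (𝓑 : Basis (Fin m) F K) :
    (Fin n → K) →ₗ[F] Matrix (Fin n) (Fin m) F where
  toFun v := Matrix.of fun i j => 𝓑.repr (v i) j
  map_add' v w := by
    ext i j
    simp
  map_smul' c v := by
    ext i j
    simp

/-- The matrix code `λ_𝓑(C)` associated to a vector code `C` and a basis `𝓑`. -/
def associatedCode (𝓑 : Basis (Fin m) F K) (C : Submodule K (Fin n → K)) :
    Submodule F (Matrix (Fin n) (Fin m) F) :=
  (C.restrictScalars F).map (basisExpansion 𝓑)

/-- A vector code is dually AMRD (with respect to `𝓑`) if its associated code is. -/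
def IsDuallyAMRDVec (𝓑 : Basis (Fin m) F K) (C : Submodule K (Fin n → K)) : Prop :=
  IsDuallyAMRD (associatedCode 𝓑 C)

end VectorCodes

end

end RankMetric

/-! For a subspace `U` of `Fⁿ`, let `C_U` be the subcode of matrices whose columns lie in `U`. The
sum of `|C_U|` over all `U` of dimension `u` counts each codeword once for every `U` containing its
column space, a number depending only on the rank. These sums therefore form a triangular system
that determines the rank distribution (`matRankDist_eq_of_sum_card_eq`).

Duality relates `dim C_U` to the dimension of the subcode of `C^⊥` on `U^⊥`
(`finrank_inf_columnsIn`). The AMRD hypotheses force `n = 2d` and `d(C^⊥) = d`. So for `u ≠ d` one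
of `U`, `U^⊥` is too small to carry a nonzero codeword and all dimensions are known, while for `u =
d` the map `U ↦ U^⊥` matches the two sums. Vector codes reduce to matrix codes through the
trace-dual basis (`matDual_associatedCode`). -/

namespace RankMetric

/-! ### Trace duality and subcodes with prescribed column space -/

section Duality

variable {F : Type*} [Field F] {n m : ℕ}

/-- The standard dot product on `Fⁿ` as a bilinear form. -/
noncomputable def dotForm (F : Type*) [Field F] (n : ℕ) : LinearMap.BilinForm F (Fin n → F) :=
  dotProductBilin F F

theorem dotForm_apply (v w : Fin n → F) : dotForm F n v w = v ⬝ᵥ w := rfl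

theorem dotForm_isRefl : (dotForm F n).IsRefl := fun v w h => by
  rw [dotForm_apply, dotProduct_comm]
  exact h

theorem dotForm_nondegenerate : (dotForm F n).Nondegenerate := by
  refine ⟨fun v hv => ?_, fun v hv => ?_⟩
  · exact dotProduct_eq_zero v fun w => hv w
  · exact dotProduct_eq_zero v fun w => by
      rw [dotProduct_comm]
      exact hv w

/-- The form `(A, B) ↦ Tr (B Aᵗ)` on matrices. -/
noncomputable def traceTransposeForm (F : Type*) [Field F] (n m : ℕ) :
    LinearMap.BilinForm F (Matrix (Fin n) (Fin m) F) :=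
  LinearMap.mk₂ F (fun A B => (B * A.transpose).trace)
    (fun A A' B => by simp [Matrix.mul_add])
    (fun c A B => by simp)
    (fun A B B' => by simp [Matrix.add_mul])
    (fun c A B => by simp)

theorem traceTransposeForm_apply (A B : Matrix (Fin n) (Fin m) F) :
    traceTransposeForm F n m A B = (B * A.transpose).trace := rfl

theorem trace_mul_transpose_eq_sum (A B : Matrix (Fin n) (Fin m) F) :
    (B * A.transpose).trace = ∑ j, B.col j ⬝ᵥ A.col j := by
  simp only [Matrix.trace, Matrix.diag_apply, Matrix.mul_apply, Matrix.transpose_apply, dotProduct,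
    Matrix.col_apply]
  exact Finset.sum_comm

theorem traceTransposeForm_isRefl : (traceTransposeForm F n m).IsRefl := fun A B h => by
  rw [traceTransposeForm_apply, ← Matrix.trace_transpose, Matrix.transpose_mul,
    Matrix.transpose_transpose]
  exact h

/-- A rank-one test matrix supported in column `j` isolates that column of `B`. This gives both
nondegeneracy of the form and the dual of `columnsIn`. -/
theorem trace_mul_transpose_vecMulVec_single (B : Matrix (Fin n) (Fin m) F) (v : Fin n → F)
    (j : Fin m) :
    (B * (Matrix.vecMulVec v (Pi.single j 1)).transpose).trace = B.col j ⬝ᵥ v := by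
  rw [trace_mul_transpose_eq_sum, Finset.sum_eq_single j]
  · congr 1
    ext i
    simp [Matrix.vecMulVec_apply]
  · intro k _ hk
    simp [Matrix.vecMulVec_apply, dotProduct, hk]
  · simp

theorem traceTransposeForm_nondegenerate : (traceTransposeForm F n m).Nondegenerate := by
  have key : ∀ B : Matrix (Fin n) (Fin m) F, (∀ A : Matrix (Fin n) (Fin m) F, (B * A.transpose).trace = 0) → B = 0 := by
    intro B hB
    ext i j
    have := dotProduct_eq_zero (B.col j) fun v => by
      rw [← trace_mul_transpose_vecMulVec_single]
      exact hB _
    exact congrFun this i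
  exact ⟨fun A hA => key A fun B => traceTransposeForm_isRefl _ _ (hA B), fun B hB => key B hB⟩

theorem matDual_eq_orthogonal (C : Submodule F (Matrix (Fin n) (Fin m) F)) :
    matDual C = (traceTransposeForm F n m).orthogonal C := rfl

theorem finrank_matDual_add (C : Submodule F (Matrix (Fin n) (Fin m) F)) :
    finrank F (matDual C) + finrank F C = n * m := by
  have h := LinearMap.BilinForm.finrank_orthogonal
    (traceTransposeForm_nondegenerate (F := F) (n := n) (m := m)) C
  have h' := Submodule.finrank_le C
  rw [Module.finrank_matrix, Fintype.card_fin, Fintype.card_fin, finrank_self, mul_one] at h h'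
  rw [matDual_eq_orthogonal, h]
  omega

/-- The matrices all of whose columns lie in `U`. -/
def columnsIn (m : ℕ) (U : Submodule F (Fin n → F)) :
    Submodule F (Matrix (Fin n) (Fin m) F) where
  carrier := {A | ∀ j, A.col j ∈ U}
  add_mem' hA hB j := U.add_mem (hA j) (hB j)
  zero_mem' _ := U.zero_mem
  smul_mem' c _ hA j := U.smul_mem c (hA j)

theorem mem_columnsIn {U : Submodule F (Fin n → F)} {A : Matrix (Fin n) (Fin m) F} :
    A ∈ columnsIn m U ↔ ∀ j, A.col j ∈ U := Iff.rfl

theorem mem_columnsIn_iff_range_le {U : Submodule F (Fin n → F)} {A : Matrix (Fin n) (Fin m) F} :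
    A ∈ columnsIn m U ↔ LinearMap.range A.mulVecLin ≤ U := by
  rw [Matrix.range_mulVecLin, Submodule.span_le, Set.range_subset_iff]
  rfl

theorem rank_le_of_mem_columnsIn {U : Submodule F (Fin n → F)} {A : Matrix (Fin n) (Fin m) F}
    (h : A ∈ columnsIn m U) : A.rank ≤ finrank F U :=
  Submodule.finrank_mono (mem_columnsIn_iff_range_le.1 h)

theorem finrank_columnsIn (U : Submodule F (Fin n → F)) :
    finrank F (columnsIn m U) = m * finrank F U := by
  let e : columnsIn m U ≃ₗ[F] (Fin m → U) :=
    { toFun := fun A j => ⟨A.1.col j, A.2 j⟩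
      invFun := fun f => ⟨Matrix.of fun i j => (f j).1 i, fun j => (f j).2⟩
      map_add' := fun _ _ => rfl
      map_smul' := fun _ _ => rfl
      left_inv := fun _ => rfl
      right_inv := fun _ => rfl }
  rw [e.finrank_eq, Module.finrank_pi_fintype]
  simp

theorem matDual_columnsIn (U : Submodule F (Fin n → F)) :
    matDual (columnsIn m U) = columnsIn m ((dotForm F n).orthogonal U) := by
  ext B
  constructor
  · intro hB j v hv
    change v ⬝ᵥ B.col j = 0
    rw [dotProduct_comm, ← trace_mul_transpose_vecMulVec_single]
    refine hB _ fun k => ?_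
    have : (Matrix.vecMulVec v (Pi.single j 1)).col k = (Pi.single j (1 : F) : Fin m → F) k • v := by
      ext i
      simp [Matrix.vecMulVec_apply, mul_comm]
    rw [this]
    exact U.smul_mem _ hv
  · intro hB A hA
    rw [trace_mul_transpose_eq_sum]
    refine Finset.sum_eq_zero fun j _ => ?_
    rw [dotProduct_comm]
    exact hB j _ (hA j)

theorem matDual_sup (C D : Submodule F (Matrix (Fin n) (Fin m) F)) :
    matDual (C ⊔ D) = matDual C ⊓ matDual D := by
  refine le_antisymm (le_inf (fun B hB A hA => hB A (Submodule.mem_sup_left hA))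
    fun B hB A hA => hB A (Submodule.mem_sup_right hA)) ?_
  rintro B ⟨hC, hD⟩ A hA
  obtain ⟨X, hX, Y, hY, rfl⟩ := Submodule.mem_sup.1 hA
  rw [Matrix.transpose_add, Matrix.mul_add, Matrix.trace_add, hC X hX, hD Y hY, add_zero]

/-- The MacWilliams duality for the subcode of matrices with columns in a given subspace. -/
theorem finrank_inf_columnsIn (C : Submodule F (Matrix (Fin n) (Fin m) F))
    (U : Submodule F (Fin n → F)) :
    finrank F (C ⊓ columnsIn m U : Submodule F _) + n * m =
      finrank F C + m * finrank F U +
        finrank F (matDual C ⊓ columnsIn m ((dotForm F n).orthogonal U) : Submodule F _) := by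
  -- The dimension of `C ⊔ columnsIn m U` is computed twice: by the modular formula and from its
  -- dual, which is an intersection.
  have h₁ := Submodule.finrank_sup_add_finrank_inf_eq C (columnsIn m U)
  have h₂ := finrank_matDual_add (C ⊔ columnsIn m U)
  rw [matDual_sup, matDual_columnsIn] at h₂
  rw [finrank_columnsIn] at h₁
  omega

theorem matMinDist_le_rank {C : Submodule F (Matrix (Fin n) (Fin m) F)}
    {A : Matrix (Fin n) (Fin m) F} (hA : A ∈ C) (h0 : A ≠ 0) : matMinDist C ≤ A.rank :=
  Nat.sInf_le ⟨A, hA, h0, rfl⟩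

theorem inf_columnsIn_eq_bot {C : Submodule F (Matrix (Fin n) (Fin m) F)}
    {U : Submodule F (Fin n → F)} (h : finrank F U < matMinDist C) : C ⊓ columnsIn m U = ⊥ := by
  rw [eq_bot_iff]
  rintro A ⟨hA, hAU⟩
  by_contra h0
  exact absurd (matMinDist_le_rank hA h0) (not_le.2 ((rank_le_of_mem_columnsIn hAU).trans_lt h))

end Duality

/-! ### Counting subspaces and inverting a triangular system -/

section Counting

variable {F : Type*} [Field F]

/-- Isomorphisms `W ≃ W'` and `P ≃ P'` between the subspaces and between chosen complements glue to
an automorphism of `V`. -/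
theorem exists_linearEquiv_map_eq {V : Type*} [AddCommGroup V] [Module F V] [FiniteDimensional F V]
    {W W' : Submodule F V} (h : finrank F W = finrank F W') :
    ∃ e : V ≃ₗ[F] V, W.map (e : V →ₗ[F] V) = W' := by
  obtain ⟨P, hP⟩ := W.exists_isCompl
  obtain ⟨P', hP'⟩ := W'.exists_isCompl
  have hPP : finrank F P = finrank F P' := by
    have h₁ := Submodule.finrank_add_eq_of_isCompl hP
    have h₂ := Submodule.finrank_add_eq_of_isCompl hP'
    omega
  let f := LinearEquiv.ofFinrankEq W W' h
  let g := LinearEquiv.ofFinrankEq P P' hPP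
  let e : V ≃ₗ[F] V := (Submodule.prodEquivOfIsCompl W P hP).symm ≪≫ₗ
    (f.prodCongr g) ≪≫ₗ Submodule.prodEquivOfIsCompl W' P' hP'
  have he : ∀ w : W, e w = f w := by
    intro w
    simp [e]
  refine ⟨e, Submodule.eq_of_le_of_finrank_eq ?_ ?_⟩
  · rintro _ ⟨w, hw, rfl⟩
    have := he ⟨w, hw⟩
    change e w ∈ W'
    rw [this]
    exact (f _).2
  · rw [LinearEquiv.finrank_map_eq, h]

/-- The number of `u`-dimensional subspaces containing `W` depends only on `dim W`. -/
theorem card_subspaces_ge_congr {V : Type*} [AddCommGroup V] [Module F V] [FiniteDimensional F V]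
    {W W' : Submodule F V} (h : finrank F W = finrank F W') (u : ℕ) :
    Nat.card {U : Submodule F V // finrank F U = u ∧ W ≤ U} =
      Nat.card {U : Submodule F V // finrank F U = u ∧ W' ≤ U} := by
  obtain ⟨e, rfl⟩ := exists_linearEquiv_map_eq h
  refine Nat.card_congr ((Submodule.orderIsoMapComap e).toEquiv.subtypeEquiv fun U => ?_)
  refine and_congr ?_ ?_
  · change _ ↔ finrank F (U.map (e : V →ₗ[F] V)) = u
    rw [LinearEquiv.finrank_map_eq]
  · exact (Submodule.map_le_map_iff_of_injective e.injective W U).symm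

/-- If a weight `N` is supported in `[0, u]` and nonzero at `u`, the number of elements of
degree `u` is determined by the weighted count and by the numbers of elements of smaller degree. -/
theorem card_fiber_eq_of_sum_eq {α : Type*} (s t : Finset α) (f : α → ℕ) (N : ℕ → ℕ) (u : ℕ) (hN : ∀ i, u < i → N i = 0) (hu : N u ≠ 0)
    (hsum : ∑ a ∈ s, N (f a) = ∑ a ∈ t, N (f a))
    (ih : ∀ i < u, (s.filter fun a => f a = i).card = (t.filter fun a => f a = i).card) :
    (s.filter fun a => f a = u).card = (t.filter fun a => f a = u).card := by
  have key : ∀ r : Finset α, ∑ a ∈ r, N (f a) =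
      (∑ i ∈ Finset.range u, (r.filter fun a => f a = i).card * N i) +
        (r.filter fun a => f a = u).card * N u := by
    intro r
    rw [← Finset.sum_range_succ (fun i => (r.filter fun a => f a = i).card * N i)]
    simp only [Finset.card_filter, Finset.sum_mul]
    rw [Finset.sum_comm]
    refine Finset.sum_congr rfl fun a _ => ?_
    simp only [ite_mul, one_mul, zero_mul]
    rw [Finset.sum_ite_eq]
    split_ifs with ha
    · rfl
    · exact hN _ (by simpa using ha)
  rw [key s, key t,
    Finset.sum_congr rfl fun i hi => by rw [ih i (Finset.mem_range.1 hi)]] at hsum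
  exact Nat.eq_of_mul_eq_mul_right (Nat.pos_of_ne_zero hu) (Nat.add_left_cancel hsum)

end Counting

/-! ### Rank distributions and formal self-duality of matrix codes -/

section RankDistribution

variable {F : Type*} [Field F] [Finite F] {n m : ℕ}

/-- The rank distributions of two codes agree if, for every `u`, the subcodes of matrices with
columns in a `u`-dimensional subspace have the same total size. -/
theorem matRankDist_eq_of_sum_card_eq (C D : Submodule F (Matrix (Fin n) (Fin m) F))
    (h : ∀ u, ∑ᶠ U ∈ {U : Submodule F (Fin n → F) | finrank F U = u},
        Nat.card (C ⊓ columnsIn m U : Submodule F _) =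
      ∑ᶠ U ∈ {U : Submodule F (Fin n → F) | finrank F U = u},
        Nat.card (D ⊓ columnsIn m U : Submodule F _)) (i : ℕ) :
    matRankDist C i = matRankDist D i := by
  classical
  have := Fintype.ofFinite F
  have := Fintype.ofFinite (Submodule F (Fin n → F))
  have := Fintype.ofFinite (Matrix (Fin n) (Fin m) F)
  let words (E : Submodule F (Matrix (Fin n) (Fin m) F)) : Finset (Matrix (Fin n) (Fin m) F) :=
    Finset.univ.filter (· ∈ E)
  have hdist : ∀ E i, matRankDist E i = ((words E).filter fun A => A.rank = i).card := by
    intro E i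
    rw [matRankDist, ← Set.ncard_coe_finset]
    congr 1
    ext A
    simp [words]
  have hN : ∀ u, ∃ N : ℕ → ℕ, ∀ W : Submodule F (Fin n → F),
      Nat.card {U : Submodule F (Fin n → F) // finrank F U = u ∧ W ≤ U} = N (finrank F W) := by
    intro u
    refine ⟨fun i => if hi : ∃ W : Submodule F (Fin n → F), finrank F W = i then
      Nat.card {U : Submodule F (Fin n → F) // finrank F U = u ∧ hi.choose ≤ U} else 0, fun W => ?_⟩
    have hi : ∃ W' : Submodule F (Fin n → F), finrank F W' = finrank F W := ⟨W, rfl⟩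
    simp only [dif_pos hi]
    exact card_subspaces_ge_congr hi.choose_spec.symm u
  have hcount : ∀ (E : Submodule F (Matrix (Fin n) (Fin m) F)) (u : ℕ),
      ∑ᶠ U ∈ {U : Submodule F (Fin n → F) | finrank F U = u},
        Nat.card (E ⊓ columnsIn m U : Submodule F _) =
      ∑ A ∈ words E, Nat.card {U : Submodule F (Fin n → F) //
        finrank F U = u ∧ LinearMap.range A.mulVecLin ≤ U} := by
    intro E u
    rw [finsum_mem_eq_finite_toFinset_sum _ (Set.toFinite _)]
    -- Double count of the pairs `(A, U)` with the column space of `A` inside `U`.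
    have := Finset.sum_card_bipartiteAbove_eq_sum_card_bipartiteBelow
      (s := words E) (t := Finset.univ.filter fun U : Submodule F (Fin n → F) => finrank F U = u)
      (fun A U => LinearMap.range A.mulVecLin ≤ U)
    refine Eq.trans (Finset.sum_congr (by ext; simp) fun U _ => ?_)
      (this.symm.trans (Finset.sum_congr rfl fun A _ => ?_))
    · rw [Nat.card_eq_fintype_card, Fintype.card_subtype]
      congr 1
      ext A
      simp [words, Finset.bipartiteBelow, mem_columnsIn_iff_range_le]
    · rw [Nat.card_eq_fintype_card, Fintype.card_subtype]
      congr 1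
      ext U
      simp [Finset.bipartiteAbove]
  induction i using Nat.strong_induction_on with
  | _ u ih =>
    obtain ⟨N, hN⟩ := hN u
    rw [hdist, hdist]
    by_cases hW : ∃ W : Submodule F (Fin n → F), finrank F W = u
    · obtain ⟨W, hW⟩ := hW
      have hNu : N u ≠ 0 := by
        rw [← hW, ← hN W]
        exact (Nat.card_pos_iff.2 ⟨⟨⟨W, hW, le_rfl⟩⟩, inferInstance⟩).ne'
      -- `N` is constrained only at dimensions that occur. Truncating above `u` changes nothing
      -- there, since no `u`-dimensional space contains a larger one.
      let N' : ℕ → ℕ := fun i => if i ≤ u then N i else 0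
      have hN' : ∀ W : Submodule F (Fin n → F), N (finrank F W) = N' (finrank F W) := by
        intro W
        simp only [N']
        split_ifs with hWu
        · rfl
        · rw [← hN W, Nat.card_eq_zero]
          exact Or.inl ⟨fun U => hWu ((Submodule.finrank_mono U.2.2).trans_eq U.2.1)⟩
      refine card_fiber_eq_of_sum_eq _ _ _ N' u (fun i hi => if_neg (not_le.2 hi))
        (by simpa [N'] using hNu) ?_ fun i hi => by rw [← hdist, ← hdist, ih i hi]
      have := h u
      rw [hcount, hcount] at this
      simp only [hN, hN'] at this
      exact this
    · have hempty : ∀ s : Finset (Matrix (Fin n) (Fin m) F),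
          (s.filter fun A => A.rank = u) = ∅ := by
        intro s
        exact Finset.filter_eq_empty_iff.2 fun A _ hA => hW ⟨_, hA⟩
      rw [hempty, hempty]

/-- A code of dimension `dm` in the `2d × m` matrices which, like its dual, has minimum distance
`d` is formally self-dual. -/
theorem isFormallySelfDual_of_matMinDist_eq {C : Submodule F (Matrix (Fin n) (Fin m) F)} {d : ℕ}
    (hn : n = 2 * d) (hdim : finrank F C = d * m) (hC : matMinDist C = d)
    (hC' : matMinDist (matDual C) = d) : IsFormallySelfDual C := by
  have hnm : n * m = 2 * (d * m) := by rw [hn, mul_assoc]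
  have hcard : ∀ E : Submodule F (Matrix (Fin n) (Fin m) F),
      Nat.card E = Nat.card F ^ finrank F E := fun E => Module.natCard_eq_pow_finrank
  have hperp : ∀ U : Submodule F (Fin n → F),
      finrank F ((dotForm F n).orthogonal U) = n - finrank F U := fun U => by
    rw [LinearMap.BilinForm.finrank_orthogonal dotForm_nondegenerate, Module.finrank_fin_fun]
  have hle : ∀ U : Submodule F (Fin n → F), finrank F U ≤ n := fun U => by
    simpa using Submodule.finrank_le U
  have hdual : ∀ U : Submodule F (Fin n → F),
      finrank F (C ⊓ columnsIn m U : Submodule F _) + d * m = m * finrank F U +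
        finrank F (matDual C ⊓ columnsIn m ((dotForm F n).orthogonal U) : Submodule F _) :=
    fun U => by
      have := finrank_inf_columnsIn C U
      rw [hdim, hnm] at this
      omega
  have hoo : ∀ U : Submodule F (Fin n → F),
      (dotForm F n).orthogonal ((dotForm F n).orthogonal U) = U :=
    LinearMap.BilinForm.orthogonal_orthogonal dotForm_nondegenerate dotForm_isRefl
  refine matRankDist_eq_of_sum_card_eq C (matDual C) fun u => ?_
  simp only [hcard]
  rcases lt_trichotomy u d with hu | rfl | hu
  · refine finsum_mem_congr rfl fun U hU => ?_
    rw [inf_columnsIn_eq_bot (by rw [hC]; exact hU.trans_lt hu),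
      inf_columnsIn_eq_bot (by rw [hC']; exact hU.trans_lt hu)]
  -- In the middle dimension the individual sizes are unknown, but duality equates the term of `C`
  -- at `U` with that of `C^⊥` at `U^⊥`.
  · refine finsum_mem_eq_of_bijOn (dotForm F n).orthogonal ⟨fun U hU => ?_, fun U _ U' _ h => ?_,
      fun U hU => ⟨(dotForm F n).orthogonal U, ?_, hoo U⟩⟩ fun U hU => ?_
    · have hU : finrank F U = u := hU
      change finrank F _ = u
      rw [hperp]
      omega
    · rw [← hoo U, ← hoo U', h]
    · have hU : finrank F U = u := hU
      change finrank F _ = u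
      rw [hperp]
      omega
    · have h := hdual U
      rw [show finrank F U = u from hU, mul_comm m] at h
      congr 1
      omega
  · refine finsum_mem_congr rfl fun U hU => ?_
    have hU : finrank F U = u := hU
    have hlt : finrank F ((dotForm F n).orthogonal U) < d := by
      rw [hperp]
      have := hle U
      omega
    -- Duality at `U` and at `U^⊥`, each with one trivial subcode, gives both remaining dimensions
    -- as `m * (u - d)`.
    have h₁ := hdual U
    have h₂ := hdual ((dotForm F n).orthogonal U)
    rw [hoo, inf_columnsIn_eq_bot (hlt.trans_eq hC.symm), hperp, hU] at h₂
    rw [inf_columnsIn_eq_bot (hlt.trans_eq hC'.symm), hU] at h₁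
    rw [finrank_bot] at h₁ h₂
    have hsub : m * (n - u) + m * u = 2 * (d * m) := by
      rw [← mul_add, Nat.sub_add_cancel (hU ▸ hle U), mul_comm, hnm]
    congr 1
    omega

/-- A dually AMRD code of dimension `dm` and minimum distance `d` in the `2d × m` matrices is
formally self-dual. -/
theorem IsDuallyAMRD.isFormallySelfDual {C : Submodule F (Matrix (Fin n) (Fin m) F)} {d : ℕ}
    (h : IsDuallyAMRD C) (hm : 0 < m) (hn : n = 2 * d) (hdim : finrank F C = d * m)
    (hC : matMinDist C = d) : IsFormallySelfDual C := by
  refine isFormallySelfDual_of_matMinDist_eq hn hdim hC ?_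
  have hd := finrank_matDual_add C
  have hdim' : finrank F (matDual C) = d * m := by
    have hnm : n * m = 2 * (d * m) := by rw [hn, mul_assoc]
    omega
  -- Since `dm / m = d` exactly, the ceiling is harmless and defect one reads `d(C^⊥) = n - d = d`.
  have h2 : rankDefect (matDual C) = 1 := h.2
  rw [rankDefect, hdim', Nat.cast_mul,
    mul_div_cancel_right₀ _ (Nat.cast_ne_zero.2 hm.ne'), Int.ceil_natCast] at h2
  omega

end RankDistribution

/-! ### Transfer between vector codes and matrix codes -/

section VectorCodes

variable {F K : Type*} [Field F] [Field K] [Algebra F K] {n m : ℕ}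

theorem basisExpansion_apply (𝓑 : Basis (Fin m) F K) (v : Fin n → K) (i : Fin n) (j : Fin m) :
    basisExpansion 𝓑 v i j = 𝓑.repr (v i) j := rfl

theorem basisExpansion_bijective (𝓑 : Basis (Fin m) F K) :
    Function.Bijective (basisExpansion (n := n) 𝓑) := by
  refine ⟨fun v w h => ?_, fun A => ⟨fun i => 𝓑.equivFun.symm (A i), ?_⟩⟩
  · ext i
    refine 𝓑.ext_elem fun j => ?_
    rw [← basisExpansion_apply, ← basisExpansion_apply, h]
  · ext i j
    rw [basisExpansion_apply, ← Basis.equivFun_apply, LinearEquiv.apply_symm_apply]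

theorem rank_basisExpansion (𝓑 : Basis (Fin m) F K) (v : Fin n → K) :
    (basisExpansion 𝓑 v).rank = vecRank F v := by
  rw [Matrix.rank_eq_finrank_span_row, vecRank,
    ← LinearEquiv.finrank_map_eq 𝓑.equivFun (Submodule.span F (Set.range v)),
    Submodule.map_span, ← Set.range_comp]
  rfl

theorem mem_associatedCode {𝓑 : Basis (Fin m) F K} {C : Submodule K (Fin n → K)}
    {v : Fin n → K} : basisExpansion 𝓑 v ∈ associatedCode 𝓑 C ↔ v ∈ C := by
  constructor
  · rintro ⟨w, hw, h⟩
    rw [← (basisExpansion_bijective 𝓑).1 h]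
    exact hw
  · exact fun h => ⟨v, h, rfl⟩

theorem matRankDist_associatedCode (𝓑 : Basis (Fin m) F K) (C : Submodule K (Fin n → K)) (i : ℕ) :
    matRankDist (associatedCode 𝓑 C) i = vecRankDist F C i := by
  rw [matRankDist, vecRankDist, ← Set.ncard_image_of_injective _ (basisExpansion_bijective 𝓑).1]
  congr 1
  ext A
  obtain ⟨v, rfl⟩ := (basisExpansion_bijective 𝓑).2 A
  rw [(basisExpansion_bijective 𝓑).1.mem_set_image]
  simp only [Set.mem_ofPred_eq, mem_associatedCode, rank_basisExpansion]

theorem matMinDist_associatedCode (𝓑 : Basis (Fin m) F K) (C : Submodule K (Fin n → K)) :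
    matMinDist (associatedCode 𝓑 C) = vecMinDist F C := by
  rw [matMinDist, vecMinDist]
  congr 1
  ext r
  simp only [Set.mem_ofPred_eq]
  rw [(basisExpansion_bijective 𝓑).2.exists]
  simp only [mem_associatedCode, rank_basisExpansion, ne_eq,
    map_eq_zero_iff _ (basisExpansion_bijective 𝓑).1]

theorem finrank_associatedCode (𝓑 : Basis (Fin m) F K) (C : Submodule K (Fin n → K)) :
    finrank F (associatedCode 𝓑 C) = finrank K C * m := by
  rw [associatedCode, ← (Submodule.equivMapOfInjective _ (basisExpansion_bijective 𝓑).1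
    (C.restrictScalars F)).finrank_eq]
  change finrank F C = _
  rw [← Module.finrank_mul_finrank F K C, Module.finrank_eq_card_basis 𝓑, Fintype.card_fin,
    mul_comm]

/-- The `j`-th coordinate of `w i` in the trace-dual basis is the trace of `w i * 𝓑 j`, so summing
against the coordinates of `v i` gives the trace of `w i * v i`. -/
theorem trace_basisExpansion_traceDual [Algebra.IsSeparable F K] [FiniteDimensional F K]
    (𝓑 : Basis (Fin m) F K) (v w : Fin n → K) :
    (basisExpansion 𝓑.traceDual w * (basisExpansion 𝓑 v).transpose).trace =
      Algebra.trace F K (w ⬝ᵥ v) := by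
  rw [dotProduct, map_sum, Matrix.trace]
  refine Finset.sum_congr rfl fun i _ => ?_
  rw [Matrix.diag_apply, Matrix.mul_apply]
  conv_rhs => rw [← 𝓑.sum_repr (v i), Finset.mul_sum, map_sum]
  refine Finset.sum_congr rfl fun j _ => ?_
  rw [Matrix.transpose_apply, basisExpansion_apply, basisExpansion_apply,
    Basis.traceDual_repr_apply, Algebra.traceForm_apply, mul_smul_comm, map_smul, smul_eq_mul,
    mul_comm]

/-- The matrix dual of the code associated to `C` is the code associated to the dual of `C`
in the trace-dual basis. -/
theorem matDual_associatedCode [Algebra.IsSeparable F K] [FiniteDimensional F K]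
    (𝓑 : Basis (Fin m) F K) (C : Submodule K (Fin n → K)) :
    matDual (associatedCode 𝓑 C) = associatedCode 𝓑.traceDual (vecDual C) := by
  ext B
  obtain ⟨w, rfl⟩ := (basisExpansion_bijective 𝓑.traceDual).2 B
  rw [mem_associatedCode]
  constructor
  · intro h v hv
    -- The hypothesis only kills traces. Because `C` is `K`-linear, `v` may be replaced by `c • v`,
    -- and nondegeneracy then kills `w ⬝ᵥ v` itself.
    refine (traceForm_nondegenerate F K).1 _ fun c => ?_
    have := h _ (mem_associatedCode.2 (C.smul_mem c hv))
    rwa [trace_basisExpansion_traceDual, dotProduct_smul, smul_eq_mul, mul_comm] at this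
  · rintro h _ ⟨v, hv, rfl⟩
    rw [trace_basisExpansion_traceDual, h v hv, map_zero]

end VectorCodes

end RankMetric

theorem mainTheorem12 {F : Type*} [Field F] [Finite F] (n m : ℕ) (hn : 1 ≤ n) (hnm : n ≤ m) :
    (∀ C : Submodule F (Matrix (Fin n) (Fin m) F),
      RankMetric.IsDuallyAMRD C →
      2 * Module.finrank F C = n * m →
      Module.finrank F C = RankMetric.matMinDist C * m →
      RankMetric.IsFormallySelfDual C) ∧
    (∀ (K : Type*) [Field K] [Algebra F K] (𝓑 : Module.Basis (Fin m) F K) (d : ℕ)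
      (C : Submodule K (Fin n → K)),
      RankMetric.IsDuallyAMRDVec 𝓑 C →
      n = 2 * d →
      Module.finrank K C = d →
      RankMetric.vecMinDist F C = d →
      RankMetric.IsFormallySelfDualVec F C) := by
  have hm : 0 < m := lt_of_lt_of_le hn hnm
  refine ⟨fun C hC h₁ h₂ => ?_, fun K _ _ 𝓑 d C hC h₁ h₂ h₃ i => ?_⟩
  · refine hC.isFormallySelfDual hm ?_ h₂ rfl
    rw [h₂, ← mul_assoc] at h₁
    exact (Nat.eq_of_mul_eq_mul_right hm h₁).symm
  · have : FiniteDimensional F K := 𝓑.finiteDimensional_of_finite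
    have h := RankMetric.IsDuallyAMRD.isFormallySelfDual hC hm h₁
      (by rw [RankMetric.finrank_associatedCode, h₂])
      (by rw [RankMetric.matMinDist_associatedCode, h₃]) i
    -- The dual code uses a different basis, but the rank distribution does not depend on the basis.
    rwa [RankMetric.matDual_associatedCode, RankMetric.matRankDist_associatedCode,
      RankMetric.matRankDist_associatedCode] at h
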